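/- All Hilbert spaces are complex. A linear relation $R$ from $\mathfrak E$ to $\mathfrak F$ is a linear subspace of $\mathfrak E\times\mathfrak F$; it is closed if it is a closed subspace, and $\overline{R}$ denotes its closure. Its domain is $\operatorname{dom}R=\{f:\{f,f'\}\in R \text{ for some } f'\}$, its multivalued part is $\operatorname{mul}R=\{f':\{0,f'\}\in R\}$, its operator part is $R_{\rm s}=\{\{f,f'\}\in R: f'\perp\operatorname{mul}R\}$ (for closed $R$ an operator with domain $\operatorname{dom} R$), its adjoint is $R^*=\{\{g,g'\}\in\mathfrak F\times\mathfrak E:(f',g)=(f,g')\text{ for all }\{f,f'\}\in R\}$, and the product of $R$ with a relation $S$ from $\mathfrak F$ to $\mathfrak G$ is $SR=\{\{f,g\}:\{f,\varphi\}\in R,\ \{\varphi,g\}\in S\text{ for some }\varphi\in\mathfrak F\}$. A bounded everywhere defined operator is identified with its graph. A relation $R$ in $\mathfrak E$ is selfadjoint if $R=R^*$ and nonnegative if $(f',f)\ge 0$ for all $\{f,f'\}\in R$; a nonnegative selfadjoint relation $R$ has a unique nonnegative selfadjoint square root $R^{1/2}$, i.e. $R^{1/2}R^{1/2}=R$. For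 nonnegative selfadjoint relations $R_1,R_2$ in $\mathfrak E$ and $c\ge 0$, the inequality $R_1\le c^2R_2$ means $$\operatorname{dom}R_2^{1/2}\subset\operatorname{dom}R_1^{1/2}\quad\text{and}\quad \|(R_1^{1/2})_{\rm s}h\|\le c\,\|(R_2^{1/2})_{\rm s}h\|\ \text{ for all } h\in\operatorname{dom}R_2^{1/2}.$$ **Corollary.** Let $\mathfrak H_A,\mathfrak H_B,\mathfrak H,\mathfrak K$ be Hilbert spaces, let $A$ be a closed linear relation from $\mathfrak H_A$ to $\mathfrak H$, let $B$ be a closed linear relation from $\mathfrak H_B$ to $\mathfrak H$, and let $c\ge 0$. If $AA^*\le c^2BB^*$, then for every linear relation $T$ from $\mathfrak H$ to $\mathfrak K$ (not necessarily closed) $$\overline{TA}\,(TA)^*\le c^2\,\overline{TB}\,(TB)^*.$$ In particular, if $AA^*\le c^2BB^*$, then for every bounded everywhere defined linear operator $T$ from $\mathfrak H$ to $\mathfrak K$ $$\overline{TA}\,A^*T^*\le c^2\,\overline{TB}\,B^*T^*.$$ (The relations compared are nonnegative and selfadjoint.) -/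

import Mathlib

open scoped ComplexOrder

/-- A linear relation from `E` to `F`: a linear subspace of `E × F`. -/
abbrev LinRel (E F : Type*) [AddCommGroup E] [Module ℂ E] [AddCommGroup F] [Module ℂ F] :=
  Submodule ℂ (E × F)

namespace LinRel

section Algebra

variable {E F G : Type*} [AddCommGroup E] [Module ℂ E] [AddCommGroup F] [Module ℂ F]
  [AddCommGroup G] [Module ℂ G]

/-- The domain of a linear relation. -/
def dom (R : LinRel E F) : Submodule ℂ E := R.map (LinearMap.fst ℂ E F)

/-- The multivalued part `{f' : {0, f'} ∈ R}` of a linear relation. -/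
def mul (R : LinRel E F) : Submodule ℂ F := R.comap (LinearMap.inr ℂ E F)

/-- The product `S R` of relations (first `R`, then `S`). -/
def comp (S : LinRel F G) (R : LinRel E F) : LinRel E G where
  carrier := {p | ∃ φ : F, (p.1, φ) ∈ R ∧ (φ, p.2) ∈ S}
  zero_mem' := ⟨0, R.zero_mem, S.zero_mem⟩
  add_mem' := by
    rintro _ _ ⟨φ, h₁, h₂⟩ ⟨ψ, h₃, h₄⟩
    exact ⟨φ + ψ, R.add_mem h₁ h₃, S.add_mem h₂ h₄⟩
  smul_mem' := by
    rintro a _ ⟨φ, h₁, h₂⟩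
    exact ⟨a • φ, R.smul_mem a h₁, S.smul_mem a h₂⟩

/-- The relation `a R = {{f, a f'} : {f, f'} ∈ R}`. -/
def scale (a : ℝ) (R : LinRel E F) : LinRel E F :=
  R.map (LinearMap.prodMap LinearMap.id ((a : ℂ) • LinearMap.id))

theorem mem_scale {a : ℝ} (ha : a ≠ 0) {R : LinRel E F} {x : E} {y : F} :
    (x, y) ∈ scale a R ↔ (x, (a : ℂ)⁻¹ • y) ∈ R := by
  have ha' : (a : ℂ) ≠ 0 := by exact_mod_cast ha
  constructor
  · rintro ⟨⟨u, v⟩, huv, h⟩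
    simp only [LinearMap.prodMap_apply, LinearMap.id_apply, LinearMap.smul_apply,
      Prod.mk.injEq] at h
    obtain ⟨rfl, rfl⟩ := h
    rwa [inv_smul_smul₀ ha']
  · intro h
    exact ⟨_, h, Prod.ext rfl (smul_inv_smul₀ ha' y)⟩

theorem mem_mul {R : LinRel E F} {y : F} : y ∈ mul R ↔ ((0 : E), y) ∈ R := Iff.rfl

theorem mem_dom {R : LinRel E F} {x : E} : x ∈ dom R ↔ ∃ y, (x, y) ∈ R := by
  simp [dom]

end Algebra

section Hilbert

variable {E F : Type*} [NormedAddCommGroup E] [InnerProductSpace ℂ E]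
  [NormedAddCommGroup F] [InnerProductSpace ℂ F]

/-- The operator part `R ⊖ ({0} × mul R)`: the pairs `{f, f'} ∈ R` with `f' ⟂ mul R`. For closed
`R` in a Hilbert space it is (the graph of) an operator with domain `dom R`. -/
noncomputable def opPart (R : LinRel E F) : LinRel E F := R ⊓ (mul R)ᗮ.comap (LinearMap.snd ℂ E F)

/-- Selfadjoint relation: `R = R*`. -/
def IsSelfadjoint (R : LinRel E E) : Prop := R.adjoint = R

/-- Nonnegative relation: `(f', f) ≥ 0` for all `{f, f'} ∈ R`. -/
def IsNonneg (R : LinRel E E) : Prop := ∀ f f' : E, (f, f') ∈ R → 0 ≤ inner ℂ f f'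

/-- `K = R^{1/2}`: the nonnegative selfadjoint relation `K` with `K K = R`. -/
def IsSqrt (K R : LinRel E E) : Prop := IsNonneg K ∧ IsSelfadjoint K ∧ comp K K = R

/-- The ordering `R₁ ≤ R₂` of nonnegative selfadjoint relations:
`dom R₂^{1/2} ⊆ dom R₁^{1/2}` and `‖(R₁^{1/2})ₛ h‖ ≤ ‖(R₂^{1/2})ₛ h‖` for `h ∈ dom R₂^{1/2}`. -/
def Le (R₁ R₂ : LinRel E E) : Prop :=
  ∃ K₁ K₂ : LinRel E E, IsSqrt K₁ R₁ ∧ IsSqrt K₂ R₂ ∧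
    dom (opPart K₂) ≤ dom (opPart K₁) ∧
    ∀ h k₁ k₂ : E, (h, k₁) ∈ opPart K₁ → (h, k₂) ∈ opPart K₂ → ‖k₁‖ ≤ ‖k₂‖

/-- The inequality `R₁ ≤ c² R₂` for nonnegative selfadjoint relations and `c ≥ 0`:
`dom R₂^{1/2} ⊆ dom R₁^{1/2}` and `‖(R₁^{1/2})ₛ h‖ ≤ c ‖(R₂^{1/2})ₛ h‖` for `h ∈ dom R₂^{1/2}`.
For `c > 0` this is the inequality `Le` between `R₁` and the relation `c² R₂`, see
`leSq_iff_le_scale`; for `c = 0` the relation `c² R₂` need not be selfadjoint. -/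
def LeSq (c : ℝ) (R₁ R₂ : LinRel E E) : Prop :=
  ∃ K₁ K₂ : LinRel E E, IsSqrt K₁ R₁ ∧ IsSqrt K₂ R₂ ∧
    dom (opPart K₂) ≤ dom (opPart K₁) ∧
    ∀ h k₁ k₂ : E, (h, k₁) ∈ opPart K₁ → (h, k₂) ∈ opPart K₂ → ‖k₁‖ ≤ c * ‖k₂‖

theorem IsSqrt.scale {a : ℝ} (ha : 0 < a) {K R : LinRel E E} (h : IsSqrt K R) :
    IsSqrt (scale a K) (LinRel.scale (a ^ 2) R) := by
  obtain ⟨hn, hs, hsq⟩ := h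
  have ha0 : a ≠ 0 := ha.ne'
  have ha' : (a : ℂ) ≠ 0 := by exact_mod_cast ha0
  refine ⟨?_, ?_, ?_⟩
  · intro f f' hf
    have h1 := hn _ _ ((mem_scale ha0).1 hf)
    have h2 : inner ℂ f f' = (a : ℂ) * inner ℂ f ((a : ℂ)⁻¹ • f') := by
      rw [inner_smul_right, mul_inv_cancel_left₀ ha']
    rw [h2]
    exact mul_nonneg (by exact_mod_cast ha.le) h1
  · unfold IsSelfadjoint at hs ⊢
    ext ⟨x, y⟩
    rw [mem_scale ha0]
    conv_rhs => rw [← hs]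
    rw [Submodule.mem_adjoint_iff, Submodule.mem_adjoint_iff]
    simp only
    constructor
    · intro H u v huv
      have := H u ((a : ℂ) • v) ((mem_scale ha0).2 (by
        rwa [inv_smul_smul₀ ha']))
      rw [inner_smul_left, Complex.conj_ofReal] at this
      rw [inner_smul_right]
      field_simp
      linear_combination this
    · intro H u v huv
      have := H u ((a : ℂ)⁻¹ • v) ((mem_scale ha0).1 huv)
      rw [inner_smul_left, inner_smul_right, ← Complex.ofReal_inv, Complex.conj_ofReal,
        ← mul_sub, mul_eq_zero] at this
      exact this.resolve_left (by simpa using ha0)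
  · subst hsq
    ext ⟨x, y⟩
    rw [mem_scale (pow_ne_zero 2 ha0)]
    have e : ∀ z : E, ((a ^ 2 : ℝ) : ℂ)⁻¹ • z = (a : ℂ)⁻¹ • (a : ℂ)⁻¹ • z := by
      intro z; rw [smul_smul]; congr 1; push_cast; field_simp
    rw [e]
    constructor
    · rintro ⟨φ, h₁, h₂⟩
      refine ⟨(a : ℂ)⁻¹ • φ, (mem_scale ha0).1 h₁, ?_⟩
      exact K.smul_mem (a : ℂ)⁻¹ ((mem_scale ha0).1 h₂)
    · rintro ⟨φ, h₁, h₂⟩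
      refine ⟨(a : ℂ) • φ, (mem_scale ha0).2 (by rwa [inv_smul_smul₀ ha']), (mem_scale ha0).2 ?_⟩
      have := K.smul_mem (a : ℂ) h₂
      simpa [smul_inv_smul₀ ha'] using this

theorem mem_opPart {R : LinRel E F} {x : E} {y : F} :
    (x, y) ∈ opPart R ↔ (x, y) ∈ R ∧ ∀ u, ((0 : E), u) ∈ R → inner ℂ u y = 0 := by
  simp [opPart, Submodule.mem_orthogonal, mem_mul]

theorem mem_opPart_scale {a : ℝ} (ha : a ≠ 0) {R : LinRel E F} {x : E} {y : F} :
    (x, y) ∈ opPart (scale a R) ↔ (x, (a : ℂ)⁻¹ • y) ∈ opPart R := by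
  have ha' : (a : ℂ) ≠ 0 := by exact_mod_cast ha
  rw [mem_opPart, mem_opPart, mem_scale ha]
  refine and_congr_right fun _ => ⟨fun h u hu => ?_, fun h u hu => ?_⟩
  · have := h u ((mem_scale ha).2 (by simpa using R.smul_mem (a : ℂ)⁻¹ hu))
    rw [inner_smul_right, this, mul_zero]
  · have := h _ ((mem_scale ha).1 hu)
    simpa [inner_smul_left, inner_smul_right, ha] using this

theorem scale_scale_inv {a : ℝ} (ha : a ≠ 0) (R : LinRel E F) : scale a⁻¹ (scale a R) = R := by
  ext ⟨x, y⟩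
  rw [mem_scale (inv_ne_zero ha), mem_scale ha]
  rw [smul_smul, ← Complex.ofReal_inv, ← Complex.ofReal_inv, ← Complex.ofReal_mul, inv_inv,
    inv_mul_cancel₀ ha, Complex.ofReal_one, one_smul]

/-- For `c > 0`, `LeSq c R₁ R₂` is the inequality `R₁ ≤ c² R₂` in the ordering `Le`. -/
theorem leSq_iff_le_scale {c : ℝ} (hc : 0 < c) (R₁ R₂ : LinRel E E) :
    LeSq c R₁ R₂ ↔ Le R₁ (scale (c ^ 2) R₂) := by
  have hc0 := hc.ne'
  have hc' : (c : ℂ) ≠ 0 := by exact_mod_cast hc0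
  constructor
  · rintro ⟨K₁, K₂, h₁, h₂, hd, hk⟩
    refine ⟨K₁, scale c K₂, h₁, h₂.scale hc, ?_, ?_⟩
    · intro x hx
      obtain ⟨y, hy⟩ := mem_dom.1 hx
      exact hd (mem_dom.2 ⟨_, (mem_opPart_scale hc0).1 hy⟩)
    · intro h k₁ k₂ h1 h2
      have := hk h k₁ _ h1 ((mem_opPart_scale hc0).1 h2)
      rwa [norm_smul, norm_inv, Complex.norm_real, Real.norm_of_nonneg hc.le,
        mul_inv_cancel_left₀ hc0] at this
  · rintro ⟨K₁, K, h₁, h, hd, hk⟩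
    have hi : c⁻¹ ≠ 0 := inv_ne_zero hc0
    refine ⟨K₁, scale c⁻¹ K, h₁, ?_, ?_, ?_⟩
    · have := h.scale (inv_pos.2 hc)
      rwa [inv_pow, scale_scale_inv (pow_ne_zero 2 hc0)] at this
    · intro x hx
      obtain ⟨y, hy⟩ := mem_dom.1 hx
      exact hd (mem_dom.2 ⟨_, (mem_opPart_scale hi).1 hy⟩)
    · intro h k₁ k₂ h1 h2
      have := hk h k₁ _ h1 ((mem_opPart_scale hi).1 h2)
      simpa [norm_smul, abs_of_pos hc] using this

end Hilbert

end LinRel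

/-! The inequality `A A* ≤ c² B B*` is a statement about adjoints: each pair `(h, k)` in `B*` has a
partner `(h, l)` in `A*` with `‖l‖ ≤ c‖k‖` (`leSq_comp_adjoint_iff`). Hence `k ↦ (A*)ₛ h` extends to
a bounded `Q` with `‖Q‖ ≤ c`, and duality gives `A ⊆ B Q*` (`exists_factorization`). Then `T A ⊆ (T
B) Q*`, so `Q` maps `(T B)*` into `(T A)*`. This is the same criterion for the products; closures do
not change adjoints, so `T` need not be closed.

The criterion requires `(C C*)^{1/2}` and `C*` to define the same form.
`exists_mem_adjoint_norm_le_iff` describes the form of `C*` through `C C*` alone, so it applies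
equally to any square root `K = K*` of `C C*`. Existence of a root comes from the resolvent. -/

namespace LinRel

/-! ### Bounded extension of norm-controlled relations -/

section Extension

variable {E F : Type*} [NormedAddCommGroup E] [InnerProductSpace ℂ E] [CompleteSpace E]
  [NormedAddCommGroup F] [InnerProductSpace ℂ F] [CompleteSpace F]

/-- A relation with `‖y‖ ≤ c ‖x‖` on its graph is contained in a bounded operator of norm at most
`c` that vanishes on the orthogonal complement of its domain. -/
theorem exists_bounded_extension (V : LinRel E F) {c : ℝ} (hc : 0 ≤ c)
    (hV : ∀ x y, (x, y) ∈ V → ‖y‖ ≤ c * ‖x‖) :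
    ∃ Q : E →L[ℂ] F, (∀ x, ‖Q x‖ ≤ c * ‖x‖) ∧ (∀ x y, (x, y) ∈ V → Q x = y) ∧
      ∀ x, (∀ u v, (u, v) ∈ V → inner ℂ u x = 0) → Q x = 0 := by
  let U : Submodule ℂ E := (dom V).topologicalClosure
  have : CompleteSpace U := (dom V).isClosed_topologicalClosure.completeSpace_coe
  have hmem : ∀ v : V, v.1.1 ∈ U := fun v =>
    (dom V).le_topologicalClosure (mem_dom.2 ⟨v.1.2, v.2⟩)
  let e : V →ₗ[ℂ] U := ((LinearMap.fst ℂ E F).comp V.subtype).codRestrict U hmem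
  let f : V →ₗ[ℂ] F := (LinearMap.snd ℂ E F).comp V.subtype
  have hd : DenseRange e := by
    intro u
    rw [Metric.mem_closure_iff]
    intro ε hε
    obtain ⟨w, hw, hdist⟩ := Metric.mem_closure_iff.1 (show u.1 ∈ closure (dom V : Set E) from u.2) ε hε
    obtain ⟨y, hy⟩ := mem_dom.1 hw
    exact ⟨e ⟨(w, y), hy⟩, ⟨_, rfl⟩, hdist⟩
  have hb : ∀ v : V, ‖f v‖ ≤ c * ‖e v‖ := fun v => hV _ _ v.2
  have hP : ∀ x, x ∈ U → ((U.orthogonalProjectionOnto x : U) : E) = x := fun x hx =>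
    U.starProjection_eq_self_iff.2 hx
  -- Extend by continuity to the closure of the domain, then precompose with the orthogonal
  -- projection onto it.
  refine ⟨(f.extendOfNorm e).comp U.orthogonalProjectionOnto, fun x => ?_, fun x y hxy => ?_,
    fun x hx => ?_⟩
  · exact (LinearMap.norm_extendOfNorm_apply_le hd c hb _).trans
      (mul_le_mul_of_nonneg_left (U.norm_starProjection_apply_le x) hc)
  · have h1 : U.orthogonalProjectionOnto x = e ⟨(x, y), hxy⟩ := Subtype.ext (hP x (hmem ⟨_, hxy⟩))
    rw [ContinuousLinearMap.comp_apply, h1, LinearMap.extendOfNorm_eq hd ⟨c, hb⟩]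
    rfl
  · have h1 : x ∈ Uᗮ := by
      rw [Submodule.orthogonal_closure, Submodule.mem_orthogonal]
      intro u hu
      obtain ⟨y, hy⟩ := mem_dom.1 hu
      exact hx u y hy
    have h2 : U.orthogonalProjectionOnto x = 0 :=
      Subtype.ext (U.starProjection_apply_eq_zero_iff.2 h1)
    rw [ContinuousLinearMap.comp_apply, h2, map_zero]

end Extension

/-! ### Adjoints and orthogonality of graphs -/

section Adjoint

variable {E F : Type*} [NormedAddCommGroup E] [InnerProductSpace ℂ E]
  [NormedAddCommGroup F] [InnerProductSpace ℂ F]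

theorem mem_comp {G : Type*} [AddCommGroup G] [Module ℂ G] {S : LinRel F G} {R : LinRel E F}
    {x : E} {z : G} : (x, z) ∈ comp S R ↔ ∃ y, (x, y) ∈ R ∧ (y, z) ∈ S := Iff.rfl

theorem mem_adjoint {C : LinRel E F} {g : F} {g' : E} :
    (g, g') ∈ C.adjoint ↔ ∀ f f', (f, f') ∈ C → inner ℂ f' g = inner ℂ f g' := by
  rw [Submodule.mem_adjoint_iff]
  exact forall₃_congr fun _ _ _ => sub_eq_zero

theorem inner_eq_of_mem_adjoint {C : LinRel E F} {f : E} {f' g : F} {g' : E}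
    (hf : (f, f') ∈ C) (hg : (g, g') ∈ C.adjoint) : inner ℂ f' g = inner ℂ f g' :=
  mem_adjoint.1 hg f f' hf

theorem inner_eq_of_mem_adjoint' {C : LinRel E F} {f : E} {f' g : F} {g' : E}
    (hf : (f, f') ∈ C) (hg : (g, g') ∈ C.adjoint) : inner ℂ g f' = inner ℂ g' f := by
  rw [← inner_conj_symm, inner_eq_of_mem_adjoint hf hg, inner_conj_symm]

theorem isClosed_adjoint (C : LinRel E F) : IsClosed (C.adjoint : Set (F × E)) := by
  have : (C.adjoint : Set (F × E)) =
      ⋂ p ∈ (C : Set (E × F)), {x | inner ℂ p.2 x.1 = inner ℂ p.1 x.2} := by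
    ext ⟨g, g'⟩
    simp [sub_eq_zero]
  rw [this]
  exact isClosed_biInter fun p _ => isClosed_eq (by fun_prop) (by fun_prop)

theorem adjoint_topologicalClosure (C : LinRel E F) :
    C.topologicalClosure.adjoint = C.adjoint := by
  ext ⟨g, g'⟩
  rw [mem_adjoint, mem_adjoint]
  refine ⟨fun h f f' hf => h f f' (C.le_topologicalClosure hf), fun h f f' hf => ?_⟩
  have hcl : IsClosed {p : E × F | inner ℂ p.2 g = inner ℂ p.1 g'} :=
    isClosed_eq (by fun_prop) (by fun_prop)
  exact closure_minimal (s := (C : Set (E × F))) (fun p hp => h p.1 p.2 hp) hcl hf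

/-- Pythagoras: `l - k` lies in `mul R`, hence is orthogonal to `k`. Norm bounds may thus be checked
on any image of `h`. -/
theorem norm_le_of_mem_opPart {R : LinRel E F} {h : E} {k l : F} (hk : (h, k) ∈ opPart R)
    (hl : (h, l) ∈ R) : ‖k‖ ≤ ‖l‖ := by
  obtain ⟨hk1, hk2⟩ := mem_opPart.1 hk
  have h0 : ((0 : E), l - k) ∈ R := by simpa using R.sub_mem hl hk1
  have h1 := norm_add_sq_eq_norm_sq_add_norm_sq_of_inner_eq_zero (l - k) k (hk2 _ h0)
  rw [sub_add_cancel] at h1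
  nlinarith [norm_nonneg l, norm_nonneg k, mul_self_nonneg ‖l - k‖]

variable [CompleteSpace E] [CompleteSpace F]

/-- The orthogonal decomposition of `E × F` with respect to a closed relation and its adjoint. -/
theorem exists_orthogonal_decomposition {C : LinRel E F} (hC : IsClosed (C : Set (E × F)))
    (p : E) (q : F) :
    ∃ f f' g g', (f, f') ∈ C ∧ (g, g') ∈ C.adjoint ∧ p = f - g' ∧ q = f' + g := by
  -- `E × F` carries the sup norm; orthogonality needs the `ℓ²` product, where `Lᗮ` is the adjoint
  -- up to the flip `(g, g') ↦ (-g', g)`.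
  let L : Submodule ℂ (WithLp 2 (E × F)) :=
    C.comap (WithLp.linearEquiv 2 ℂ (E × F) : WithLp 2 (E × F) →ₗ[ℂ] E × F)
  have hL : IsClosed (L : Set (WithLp 2 (E × F))) :=
    hC.preimage (WithLp.prod_continuous_ofLp 2 E F)
  have : CompleteSpace L := hL.completeSpace_coe
  obtain ⟨c, hc, d, hd, hz⟩ := L.exists_add_mem_mem_orthogonal (WithLp.toLp 2 (p, q))
  refine ⟨c.fst, c.snd, d.snd, -d.fst, hc, mem_adjoint.2 fun f f' hf => ?_, ?_, ?_⟩
  · have := (Submodule.mem_orthogonal _ _).1 hd (WithLp.toLp 2 (f, f')) hf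
    rw [WithLp.prod_inner_apply] at this
    rw [inner_neg_right]
    exact eq_neg_of_add_eq_zero_right this
  · simpa using congrArg WithLp.fst hz
  · simpa using congrArg WithLp.snd hz

/-- This is `C** ⊆ C`: testing against the adjoint component `(g, g')` of `(x, y)` itself gives
`‖g‖² = -‖g'‖²`. -/
theorem mem_of_forall_mem_adjoint {C : LinRel E F} (hC : IsClosed (C : Set (E × F))) {x : E}
    {y : F} (h : ∀ g g', (g, g') ∈ C.adjoint → inner ℂ g y = inner ℂ g' x) : (x, y) ∈ C := by
  obtain ⟨f, f', g, g', hf, hg, rfl, rfl⟩ := exists_orthogonal_decomposition hC x y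
  have h1 := h g g' hg
  rw [inner_add_right, inner_sub_right, inner_eq_of_mem_adjoint' hf hg, sub_eq_add_neg,
    add_right_inj] at h1
  have hg0 : ‖g‖ ^ 2 + ‖g'‖ ^ 2 = 0 := by
    rw [inner_self_eq_norm_sq_to_K, inner_self_eq_norm_sq_to_K] at h1
    have h2 : ((‖g‖ ^ 2 + ‖g'‖ ^ 2 : ℝ) : ℂ) = 0 := by
      push_cast
      exact eq_neg_iff_add_eq_zero.1 h1
    exact_mod_cast h2
  have e1 : g = 0 := by
    have : ‖g‖ = 0 := by nlinarith [sq_nonneg ‖g‖, sq_nonneg ‖g'‖]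
    simpa using this
  have e2 : g' = 0 := by
    have : ‖g'‖ = 0 := by nlinarith [sq_nonneg ‖g‖, sq_nonneg ‖g'‖]
    simpa using this
  simpa [e1, e2] using hf

end Adjoint
-- The form of `C*` expressed through `C C*`
section Bound

variable {E F : Type*} [NormedAddCommGroup E] [InnerProductSpace ℂ E] [CompleteSpace E]
  [NormedAddCommGroup F] [InnerProductSpace ℂ F] [CompleteSpace F]

omit [CompleteSpace E] in
theorem exists_mem_opPart {R : LinRel E F} (hR : IsClosed (R : Set (E × F))) {h : E} {k : F}
    (hk : (h, k) ∈ R) : ∃ l, (h, l) ∈ opPart R := by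
  have hm : IsClosed (mul R : Set F) :=
    hR.preimage (f := fun y : F => ((0 : E), y)) (by fun_prop)
  have : CompleteSpace (mul R) := hm.completeSpace_coe
  obtain ⟨c, hc, d, hd, rfl⟩ := (mul R).exists_add_mem_mem_orthogonal k
  refine ⟨d, mem_opPart.2 ⟨?_, fun u hu => (Submodule.mem_orthogonal _ _).1 hd u hu⟩⟩
  simpa using R.sub_mem hk (mem_mul.1 hc)

omit [CompleteSpace E] [CompleteSpace F] in
theorem inner_eq_norm_sq_of_mem {C : LinRel E F} {u u' : F} {φ : E} (h : (u, φ) ∈ C.adjoint)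
    (h' : (φ, u') ∈ C) : inner ℂ u u' = ((‖φ‖ ^ 2 : ℝ) : ℂ) := by
  rw [inner_eq_of_mem_adjoint' h' h, inner_self_eq_norm_sq_to_K]
  push_cast
  rfl

/-- The form bound `‖(C*)ₛ h‖ ≤ M` is expressed through the relation `C C*` alone. -/
theorem exists_mem_adjoint_norm_le_iff {C : LinRel E F} (hC : IsClosed (C : Set (E × F))) {h : F}
    {M : ℝ} (hM : 0 ≤ M) :
    (∃ k, (h, k) ∈ C.adjoint ∧ ‖k‖ ≤ M) ↔
      ∀ u u', (u, u') ∈ comp C C.adjoint → ‖inner ℂ h u'‖ ≤ M * √(inner ℂ u u').re := by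
  constructor
  · rintro ⟨k, hk, hkM⟩ u u' ⟨φ, h1, h2⟩
    rw [inner_eq_norm_sq_of_mem h1 h2, Complex.ofReal_re, Real.sqrt_sq (norm_nonneg φ),
      inner_eq_of_mem_adjoint' h2 hk]
    exact (norm_inner_le_norm _ _).trans (mul_le_mul_of_nonneg_right hkM (norm_nonneg φ))
  · intro H
    -- The functional `φ ↦ (h, u')` on intermediate vectors `φ` of `C C*`; the bound `H` also makes
    -- it single-valued. Its Riesz vector `k` is the candidate.
    let V : LinRel E ℂ :=
      { carrier := {p | ∃ u u', (u, p.1) ∈ C.adjoint ∧ (p.1, u') ∈ C ∧ p.2 = inner ℂ h u'}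
        zero_mem' := ⟨0, 0, C.adjoint.zero_mem, C.zero_mem, by simp⟩
        add_mem' := by
          rintro a b ⟨u, u', h1, h2, h3⟩ ⟨v, v', h4, h5, h6⟩
          exact ⟨u + v, u' + v', C.adjoint.add_mem h1 h4, C.add_mem h2 h5, by
            rw [inner_add_right, Prod.snd_add, h3, h6]⟩
        smul_mem' := by
          rintro r a ⟨u, u', h1, h2, h3⟩
          exact ⟨r • u, r • u', C.adjoint.smul_mem r h1, C.smul_mem r h2, by
            rw [inner_smul_right, Prod.smul_snd, h3, smul_eq_mul]⟩ }
    obtain ⟨Q, hQ, hQV, hQ0⟩ := exists_bounded_extension V hM (by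
      rintro φ z ⟨u, u', h1, h2, rfl⟩
      have := H u u' ⟨φ, h1, h2⟩
      rwa [inner_eq_norm_sq_of_mem h1 h2, Complex.ofReal_re, Real.sqrt_sq (norm_nonneg φ)] at this)
    let k : E := (InnerProductSpace.toDual ℂ E).symm Q
    have hkQ : ∀ x, inner ℂ k x = Q x := fun x => InnerProductSpace.toDual_symm_apply
    have hkM : ‖k‖ ≤ M := by
      rw [LinearIsometryEquiv.norm_map]
      exact Q.opNorm_le_bound hM hQ
    have hkV : ∀ {u φ u'}, (u, φ) ∈ C.adjoint → (φ, u') ∈ C → inner ℂ k φ = inner ℂ h u' :=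
      fun h1 h2 => by rw [hkQ]; exact hQV _ _ ⟨_, _, h1, h2, rfl⟩
    -- The kernel of `C` is orthogonal to `ran C*`, hence to the domain of `V`, where `Q` was
    -- extended by zero.
    have hker : ∀ a, (a, (0 : F)) ∈ C → inner ℂ k a = 0 := by
      intro a ha
      rw [hkQ]
      refine hQ0 a ?_
      rintro φ z ⟨u, u', h1, -, -⟩
      rw [← inner_eq_of_mem_adjoint' ha h1, inner_zero_right]
    -- `(h, k) ∈ C*` means that the component `(f, f')` of `(-k, h)` in `C` vanishes.
    obtain ⟨f, f', g, φ, hf, hg, e1, e2⟩ := exists_orthogonal_decomposition hC (-k) h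
    have ef : f = φ - k := by rw [sub_eq_neg_add, e1]; abel
    have ef' : f' = h - g := by rw [e2]; abel
    have hf0 : f' = 0 := by
      -- Writes `f' = b + a'` with `(b, a') ∈ C C*`, so that `hkV` applies to `a`.
      obtain ⟨a, a', b, b', ha, hb, e3, e4⟩ := exists_orthogonal_decomposition hC (0 : E) f'
      obtain rfl : a = b' := (sub_eq_zero.1 e3.symm)
      have h1 : inner ℂ f' f' = (0 : ℂ) := by
        refine (congrArg (inner ℂ f') e4).trans ?_
        rw [inner_add_right, inner_eq_of_mem_adjoint hf hb, ef, inner_sub_left, hkV hb ha, ef', inner_sub_left,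
          inner_eq_of_mem_adjoint' ha hg]
        ring
      exact inner_self_eq_zero.1 h1
    have hf00 : f = 0 := by
      rw [hf0] at hf
      have h1 : inner ℂ f f = (0 : ℂ) := by
        conv_lhs => rw [ef]
        rw [inner_sub_left, ← ef, hker f hf, ← inner_eq_of_mem_adjoint' hf hg]
        simp
      exact inner_self_eq_zero.1 h1
    refine ⟨k, ?_, hkM⟩
    rwa [← sub_eq_zero.1 (ef.symm.trans hf00), sub_eq_zero.1 (ef'.symm.trans hf0)]

end Bound

/-! ### Square roots of nonnegative relations -/

section SquareRoot

variable {E : Type*} [NormedAddCommGroup E] [InnerProductSpace ℂ E] [CompleteSpace E]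

/-- The resolvent `(I + R)⁻¹` of a nonnegative relation with `ran (I + R) = E`. -/
theorem IsNonneg.exists_resolvent {R : LinRel E E} (hR : IsNonneg R)
    (hran : ∀ x, ∃ h h', (h, h') ∈ R ∧ x = h + h') :
    ∃ J : E →L[ℂ] E, 0 ≤ J ∧ 0 ≤ 1 - J ∧ ∀ h h', (h, h') ∈ R ↔ ∃ x, h = J x ∧ h' = (1 - J) x := by
  have hre : ∀ {h h'}, (h, h') ∈ R → 0 ≤ (inner ℂ h h').re ∧ (inner ℂ h h').im = 0 :=
    fun hh => ⟨(Complex.nonneg_iff.1 (hR _ _ hh)).1, (Complex.nonneg_iff.1 (hR _ _ hh)).2.symm⟩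
  -- The map `h + h' ↦ h` is contractive because `Re (h, h') ≥ 0`.
  let V : LinRel E E := R.map ((LinearMap.fst ℂ E E + LinearMap.snd ℂ E E).prod (LinearMap.fst ℂ E E))
  obtain ⟨J, -, hJ, -⟩ := exists_bounded_extension V zero_le_one (by
    rintro x y ⟨⟨h, h'⟩, hh, e⟩
    obtain ⟨rfl, rfl⟩ := Prod.mk.inj (show (h + h', h) = (x, y) from e)
    have h1 := norm_add_sq (𝕜 := ℂ) h h'
    have h2 : 0 ≤ RCLike.re (inner ℂ h h') := (hre hh).1
    rw [one_mul]
    exact (sq_le_sq₀ (norm_nonneg _) (norm_nonneg _)).1 (by nlinarith [sq_nonneg ‖h'‖]))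
  have hJ' : ∀ {h h'}, (h, h') ∈ R → J (h + h') = h := fun hh => hJ _ _ ⟨_, hh, rfl⟩
  have key : ∀ x, ∃ h', (J x, h') ∈ R ∧ x = J x + h' := by
    intro x
    obtain ⟨h, h', hh, rfl⟩ := hran x
    rw [hJ' hh]
    exact ⟨h', hh, rfl⟩
  refine ⟨J, ?_, ?_, fun h h' => ⟨fun hh => ⟨h + h', (hJ' hh).symm, ?_⟩, ?_⟩⟩
  · rw [ContinuousLinearMap.nonneg_iff_isPositive, ContinuousLinearMap.isPositive_iff_complex]
    intro x
    obtain ⟨h', hh, e⟩ := key x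
    have h0 := hre hh
    have h1 : inner ℂ (J x) x = ((‖J x‖ ^ 2 + (inner ℂ (J x) h').re : ℝ) : ℂ) := by
      refine (congrArg (inner ℂ (J x)) e).trans ?_
      rw [inner_add_right, inner_self_eq_norm_sq_to_K]
      refine Complex.ext ?_ ?_ <;> simp [h0.2, ← Complex.ofReal_pow]
    rw [h1]
    refine ⟨congrArg Complex.ofReal (Complex.ofReal_re _), ?_⟩
    simp only [RCLike.re_to_complex, Complex.ofReal_re]
    exact add_nonneg (sq_nonneg _) h0.1
  · rw [ContinuousLinearMap.nonneg_iff_isPositive, ContinuousLinearMap.isPositive_iff_complex]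
    intro x
    obtain ⟨h', hh, e⟩ := key x
    have h0 := hre hh
    have e' : (1 - J) x = h' := by
      rw [sub_apply, one_apply_eq_self]
      exact sub_eq_iff_eq_add'.2 e
    have h2 : inner ℂ h' (J x) = inner ℂ (J x) h' := by
      rw [← inner_conj_symm]
      exact Complex.conj_eq_iff_im.2 h0.2
    have h1 : inner ℂ ((1 - J) x) x = ((‖h'‖ ^ 2 + (inner ℂ (J x) h').re : ℝ) : ℂ) := by
      rw [e']
      refine (congrArg (inner ℂ h') e).trans ?_
      rw [inner_add_right, h2, inner_self_eq_norm_sq_to_K]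
      refine Complex.ext ?_ ?_ <;> simp [h0.2, ← Complex.ofReal_pow, add_comm]
    rw [h1]
    refine ⟨congrArg Complex.ofReal (Complex.ofReal_re _), ?_⟩
    simp only [RCLike.re_to_complex, Complex.ofReal_re]
    exact add_nonneg (sq_nonneg _) h0.1
  · rw [sub_apply, one_apply_eq_self, hJ' hh, add_sub_cancel_left]
  · rintro ⟨x, rfl, rfl⟩
    obtain ⟨h', hh, e⟩ := key x
    rw [sub_apply, one_apply_eq_self]
    rwa [sub_eq_iff_eq_add'.2 e]

/-- A nonnegative relation with `ran (I + R) = E` has a nonnegative selfadjoint square root. -/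
theorem IsNonneg.exists_isSqrt {R : LinRel E E} (hR : IsNonneg R)
    (hran : ∀ x, ∃ h h', (h, h') ∈ R ∧ x = h + h') : ∃ K, IsSqrt K R := by
  obtain ⟨J, hJ, hJ1, hRJ⟩ := hR.exists_resolvent hran
  let a := CFC.sqrt J
  let b := CFC.sqrt (1 - J)
  have ha : 0 ≤ a := CFC.sqrt_nonneg J
  have hb : 0 ≤ b := CFC.sqrt_nonneg (1 - J)
  have haa : a * a = J := CFC.sqrt_mul_sqrt_self J
  have hbb : b * b = 1 - J := CFC.sqrt_mul_sqrt_self (1 - J)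
  have hab : Commute a b := by
    have h1 : Commute J (1 - J) := (Commute.one_right J).sub_right (Commute.refl J)
    exact ((h1.cfcₙ_nnreal NNReal.sqrt).symm.cfcₙ_nnreal NNReal.sqrt).symm
  have hab0 : 0 ≤ a * b := hab.mul_nonneg ha hb
  have aa : ∀ x, a (a x) = J x := fun x => DFunLike.congr_fun haa x
  have bb : ∀ x, b (b x) = x - J x := fun x => DFunLike.congr_fun hbb x
  have ba : ∀ x, b (a x) = a (b x) := fun x => (DFunLike.congr_fun hab.eq x).symm
  have sa : ∀ x y, inner ℂ (a x) y = inner ℂ x (a y) :=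
    ((ContinuousLinearMap.nonneg_iff_isPositive a).1 ha).isSymmetric
  have sb : ∀ x y, inner ℂ (b x) y = inner ℂ x (b y) :=
    ((ContinuousLinearMap.nonneg_iff_isPositive b).1 hb).isSymmetric
  -- `R` consists of the pairs `(a² x, b² x)`, so its root is `{(a w, b w)}`; the commuting `a`, `b`
  -- satisfy `a² + b² = 1`.
  let K : LinRel E E := LinearMap.range ((a : E →ₗ[ℂ] E).prod (b : E →ₗ[ℂ] E))
  have hK : ∀ {x y}, (x, y) ∈ K ↔ ∃ w, a w = x ∧ b w = y := by
    intro x y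
    simp [K, LinearMap.mem_range]
  refine ⟨K, ?_, ?_, ?_⟩
  · rintro f f' hf
    obtain ⟨w, rfl, rfl⟩ := hK.1 hf
    rw [sa]
    exact ((ContinuousLinearMap.nonneg_iff_isPositive (a * b)).1 hab0).inner_nonneg_right w
  · unfold IsSelfadjoint
    ext ⟨g, g'⟩
    rw [mem_adjoint, hK]
    constructor
    · intro H
      have h1 : b g = a g' := by
        refine ext_inner_left ℂ fun v => ?_
        rw [← sb, ← sa]
        exact H _ _ (hK.2 ⟨v, rfl, rfl⟩)
      -- If `g = a w` and `g' = b w`, then `a² + b² = 1` forces `w = a g + b g'`.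
      refine ⟨a g + b g', ?_, ?_⟩
      · rw [map_add, aa, ← ba, ← h1, bb]; abel
      · rw [map_add, bb, ba, h1, aa]; abel
    · rintro ⟨w, rfl, rfl⟩ f f' hf
      obtain ⟨v, rfl, rfl⟩ := hK.1 hf
      rw [sa, sb, ba]
  · ext ⟨x, z⟩
    rw [mem_comp, hRJ]
    constructor
    · rintro ⟨y, h1, h2⟩
      obtain ⟨v, rfl, rfl⟩ := hK.1 h1
      obtain ⟨w, e, rfl⟩ := hK.1 h2
      refine ⟨a v + b w, ?_, ?_⟩
      · rw [map_add, ← aa, ← aa (b w), ← ba w, e, ← map_add, aa, bb, add_sub_cancel]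
      · rw [sub_apply, one_apply_eq_self, ← bb, map_add, map_add,
          ba v, ← e, aa, bb, ← aa w, ba, ba, aa, add_sub_cancel]
    · rintro ⟨w, rfl, rfl⟩
      exact ⟨a (b w), hK.2 ⟨a w, aa w, ba w⟩, hK.2 ⟨b w, rfl, bb w⟩⟩

variable {F : Type*} [NormedAddCommGroup F] [InnerProductSpace ℂ F] [CompleteSpace F]

/-- Decomposing `(0, x)` along `C` and its adjoint solves `x ∈ (I + C C*) u`. -/
theorem exists_isSqrt_comp_adjoint {C : LinRel F E} (hC : IsClosed (C : Set (F × E))) :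
    ∃ K, IsSqrt K (comp C C.adjoint) := by
  refine IsNonneg.exists_isSqrt ?_ fun x => ?_
  · rintro u u' ⟨φ, h1, h2⟩
    rw [inner_eq_norm_sq_of_mem h1 h2]
    exact_mod_cast sq_nonneg ‖φ‖
  · obtain ⟨f, f', g, g', hf, hg, e, rfl⟩ := exists_orthogonal_decomposition hC (0 : F) x
    obtain rfl : f = g' := sub_eq_zero.1 e.symm
    exact ⟨g, f', ⟨f, hg, hf⟩, add_comm _ _⟩

omit [CompleteSpace E] in
theorem IsSqrt.isClosed {K R : LinRel E E} (h : IsSqrt K R) : IsClosed (K : Set (E × E)) := by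
  have := isClosed_adjoint K
  rwa [h.2.1] at this

/-- The square root of `C C*` has the same form as `C*`. -/
theorem IsSqrt.exists_norm_le_iff {C : LinRel F E} (hC : IsClosed (C : Set (F × E)))
    {K : LinRel E E} (hK : IsSqrt K (comp C C.adjoint)) {h : E} {M : ℝ} (hM : 0 ≤ M) :
    (∃ k, (h, k) ∈ K ∧ ‖k‖ ≤ M) ↔ ∃ k, (h, k) ∈ C.adjoint ∧ ‖k‖ ≤ M := by
  -- Since `K K* = K K = C C*`, the criteria for `K` and `C` coincide; uniqueness of the root is not
  -- needed.
  have h1 := exists_mem_adjoint_norm_le_iff hK.isClosed (h := h) hM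
  have hs : K.adjoint = K := hK.2.1
  rw [hs, hK.2.2] at h1
  rw [h1, exists_mem_adjoint_norm_le_iff hC hM]

end SquareRoot

/-! ### The ordering, factorization and left multiplication -/

section Order

variable {E₁ E₂ F G : Type*} [NormedAddCommGroup E₁] [InnerProductSpace ℂ E₁] [CompleteSpace E₁]
  [NormedAddCommGroup E₂] [InnerProductSpace ℂ E₂] [CompleteSpace E₂]
  [NormedAddCommGroup F] [InnerProductSpace ℂ F] [CompleteSpace F]
  [NormedAddCommGroup G] [InnerProductSpace ℂ G] [CompleteSpace G]

/-- The inequality `A A* ≤ c² B B*` in terms of the forms of `A*` and `B*`. -/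
theorem leSq_comp_adjoint_iff {A : LinRel E₁ F} {B : LinRel E₂ F}
    (hA : IsClosed (A : Set (E₁ × F))) (hB : IsClosed (B : Set (E₂ × F))) {c : ℝ} (hc : 0 ≤ c) :
    LeSq c (comp A A.adjoint) (comp B B.adjoint) ↔
      ∀ h k, (h, k) ∈ B.adjoint → ∃ l, (h, l) ∈ A.adjoint ∧ ‖l‖ ≤ c * ‖k‖ := by
  constructor
  · rintro ⟨K₁, K₂, h₁, h₂, hd, hn⟩ h k hk
    obtain ⟨m, hm, hmk⟩ := (h₂.exists_norm_le_iff hB (norm_nonneg k)).2 ⟨k, hk, le_rfl⟩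
    obtain ⟨m', hm'⟩ := exists_mem_opPart h₂.isClosed hm
    obtain ⟨l, hl⟩ := mem_dom.1 (hd (mem_dom.2 ⟨m', hm'⟩))
    refine (h₁.exists_norm_le_iff hA (mul_nonneg hc (norm_nonneg k))).1
      ⟨l, (mem_opPart.1 hl).1, (hn h l m' hl hm').trans ?_⟩
    exact mul_le_mul_of_nonneg_left ((norm_le_of_mem_opPart hm' hm).trans hmk) hc
  · intro H
    obtain ⟨K₁, h₁⟩ := exists_isSqrt_comp_adjoint hA
    obtain ⟨K₂, h₂⟩ := exists_isSqrt_comp_adjoint hB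
    have key : ∀ h k, (h, k) ∈ K₂ → ∃ l, (h, l) ∈ K₁ ∧ ‖l‖ ≤ c * ‖k‖ := by
      intro h k hk
      obtain ⟨m, hm, hmk⟩ := (h₂.exists_norm_le_iff hB (norm_nonneg k)).1 ⟨k, hk, le_rfl⟩
      obtain ⟨l, hl, hlm⟩ := H h m hm
      exact (h₁.exists_norm_le_iff hA (mul_nonneg hc (norm_nonneg k))).2
        ⟨l, hl, hlm.trans (mul_le_mul_of_nonneg_left hmk hc)⟩
    refine ⟨K₁, K₂, h₁, h₂, fun h hh => ?_, fun h k₁ k₂ hk₁ hk₂ => ?_⟩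
    · obtain ⟨k, hk⟩ := mem_dom.1 hh
      obtain ⟨l, hl, -⟩ := key h k (mem_opPart.1 hk).1
      exact mem_dom.2 (exists_mem_opPart h₁.isClosed hl)
    · obtain ⟨l, hl, hlk⟩ := key h k₂ (mem_opPart.1 hk₂).1
      exact (norm_le_of_mem_opPart hk₁ hl).trans hlk

/-- Under `A A* ≤ c² B B*` there is a bounded `Q` with `‖Q‖ ≤ c` and `A ⊆ B Q*`. -/
theorem exists_factorization {A : LinRel E₁ F} {B : LinRel E₂ F}
    (hB : IsClosed (B : Set (E₂ × F))) {c : ℝ} (hc : 0 ≤ c)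
    (H : ∀ h k, (h, k) ∈ B.adjoint → ∃ l, (h, l) ∈ A.adjoint ∧ ‖l‖ ≤ c * ‖k‖) :
    ∃ Q : E₂ →L[ℂ] E₁, (∀ x, ‖Q x‖ ≤ c * ‖x‖) ∧
      ∀ f f', (f, f') ∈ A → (ContinuousLinearMap.adjoint Q f, f') ∈ B := by
  -- `V` is `(A*)ₛ (B*)⁻¹`; the bound by `c` makes it single-valued.
  let V : LinRel E₂ E₁ := comp (opPart A.adjoint) (B.adjoint.map (LinearEquiv.prodComm ℂ F E₂).toLinearMap)
  have hV : ∀ {k l}, (k, l) ∈ V ↔ ∃ h, (h, k) ∈ B.adjoint ∧ (h, l) ∈ opPart A.adjoint := by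
    intro k l
    refine exists_congr fun h => and_congr_left' ⟨?_, fun hh => ⟨_, hh, rfl⟩⟩
    rintro ⟨⟨h', k'⟩, hh, e⟩
    obtain ⟨rfl, rfl⟩ := Prod.mk.inj e
    exact hh
  obtain ⟨Q, hQ, hQV, -⟩ := exists_bounded_extension V hc (by
    intro k l hkl
    obtain ⟨h, hk, hl⟩ := hV.1 hkl
    obtain ⟨m, hm, hmk⟩ := H h k hk
    exact (norm_le_of_mem_opPart hl hm).trans hmk)
  refine ⟨Q, hQ, fun f f' hf => mem_of_forall_mem_adjoint hB fun h k hk => ?_⟩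
  obtain ⟨m, hm, -⟩ := H h k hk
  obtain ⟨l, hl⟩ := exists_mem_opPart (isClosed_adjoint A) hm
  rw [ContinuousLinearMap.adjoint_inner_right, hQV k l (hV.2 ⟨h, hk, hl⟩)]
  exact inner_eq_of_mem_adjoint' hf (mem_opPart.1 hl).1

omit [CompleteSpace E₁] in
/-- `(T A)* = A* T*` for bounded everywhere defined `T`. -/
theorem adjoint_comp_graph (T : F →L[ℂ] G) (A : LinRel E₁ F) :
    (comp (T : F →ₗ[ℂ] G).graph A).adjoint =
      comp A.adjoint (ContinuousLinearMap.adjoint T : G →ₗ[ℂ] F).graph := by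
  ext ⟨g, g'⟩
  rw [mem_adjoint, mem_comp]
  simp only [mem_comp, LinearMap.mem_graph_iff, ContinuousLinearMap.coe_coe, exists_eq_left]
  rw [mem_adjoint]
  refine ⟨fun H f φ hf => ?_, fun H f y => ?_⟩
  · rw [ContinuousLinearMap.adjoint_inner_right]
    exact H f _ ⟨φ, hf, rfl⟩
  · rintro ⟨φ, hf, rfl⟩
    rw [← ContinuousLinearMap.adjoint_inner_right]
    exact H f φ hf

/-- From `A ⊆ B Q*` follows `T A ⊆ (T B) Q*`, so `Q k` is the required partner of `h` in `(T A)*`.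
-/
theorem LeSq.comp_left {A : LinRel E₁ F} {B : LinRel E₂ F}
    (hA : IsClosed (A : Set (E₁ × F))) (hB : IsClosed (B : Set (E₂ × F))) {c : ℝ} (hc : 0 ≤ c)
    (hAB : LeSq c (comp A A.adjoint) (comp B B.adjoint)) (T : LinRel F G) :
    LeSq c (comp (comp T A).topologicalClosure (comp T A).adjoint)
      (comp (comp T B).topologicalClosure (comp T B).adjoint) := by
  obtain ⟨Q, hQ, hAQ⟩ := exists_factorization hB hc ((leSq_comp_adjoint_iff hA hB hc).1 hAB)
  rw [← adjoint_topologicalClosure (comp T A), ← adjoint_topologicalClosure (comp T B),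
    leSq_comp_adjoint_iff (Submodule.isClosed_topologicalClosure _)
      (Submodule.isClosed_topologicalClosure _) hc,
    adjoint_topologicalClosure, adjoint_topologicalClosure]
  intro h k hk
  refine ⟨Q k, mem_adjoint.2 ?_, hQ k⟩
  rintro f g ⟨φ, hf, hg⟩
  rw [← ContinuousLinearMap.adjoint_inner_left]
  exact mem_adjoint.1 hk _ _ ⟨φ, hAQ f φ hf, hg⟩

end Order

end LinRel

theorem corollary3p7 {HA HB H K : Type*}
    [NormedAddCommGroup HA] [InnerProductSpace ℂ HA] [CompleteSpace HA]
    [NormedAddCommGroup HB] [InnerProductSpace ℂ HB] [CompleteSpace HB]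
    [NormedAddCommGroup H] [InnerProductSpace ℂ H] [CompleteSpace H]
    [NormedAddCommGroup K] [InnerProductSpace ℂ K] [CompleteSpace K]
    (A : LinRel HA H) (B : LinRel HB H)
    (hA : IsClosed (A : Set (HA × H))) (hB : IsClosed (B : Set (HB × H)))
    (c : ℝ) (hc : 0 ≤ c)
    (hAB : LinRel.LeSq c (LinRel.comp A A.adjoint) (LinRel.comp B B.adjoint)) :
    (∀ T : LinRel H K,
      LinRel.LeSq c
        (LinRel.comp (LinRel.comp T A).topologicalClosure (LinRel.comp T A).adjoint)
        (LinRel.comp (LinRel.comp T B).topologicalClosure (LinRel.comp T B).adjoint)) ∧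
    (∀ T : H →L[ℂ] K,
      LinRel.LeSq c
        (LinRel.comp (LinRel.comp (T : H →ₗ[ℂ] K).graph A).topologicalClosure
          (LinRel.comp A.adjoint (ContinuousLinearMap.adjoint T : K →ₗ[ℂ] H).graph))
        (LinRel.comp (LinRel.comp (T : H →ₗ[ℂ] K).graph B).topologicalClosure
          (LinRel.comp B.adjoint (ContinuousLinearMap.adjoint T : K →ₗ[ℂ] H).graph))) := by
  have main : ∀ T : LinRel H K, _ := fun T => LinRel.LeSq.comp_left hA hB hc hAB T
  refine ⟨main, fun T => ?_⟩
  rw [← LinRel.adjoint_comp_graph, ← LinRel.adjoint_comp_graph]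
  exact main _
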